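/- An observable with (measurable) outcome space $\Omega$ on a complex Hilbert space $\mathcal H$ is a normalized positive operator valued measure $\mathsf M$ on $\Omega$, i.e. a weakly $\sigma$-additive map from measurable sets to positive bounded operators with $\mathsf M(\Omega)=\mathbb 1$. It is trivial if $\mathsf M(X)=\mu(X)\mathbb 1$ for some probability measure $\mu$. Observables $\mathsf M_1,\mathsf M_2$ on $\Omega_1,\Omega_2$ are jointly measurable if there is an observable $\mathsf M$ on $\Omega_1\times\Omega_2$ with $\mathsf M(X\times\Omega_2)=\mathsf M_1(X)$ and $\mathsf M(\Omega_1\times Y)=\mathsf M_2(Y)$ for all measurable $X,Y$. The joint measurability region $J(\mathsf M_1,\mathsf M_2)$ is the set of all $(\lambda,\mu)\in[0,1]\times[0,1]$ for which there are trivial observables $\mathsf T_1,\mathsf T_2$ such that $\lambda\mathsf M_1+(1-\lambda)\mathsf T_1$ and $\mu\mathsf M_2+(1-\mu)\mathsf T_2$ are jointly measurable. The pair is maximally incompatible if $J(\mathsf M_1,\mathsf M_2)=\{(\lambda,\mu)\in[0,1]\times[0,1] : \lambda+\mu\le 1\}$, and its joint measurability degree is the greatest $\lambda\in[0,1]$ with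 $(\lambda,\lambda)\in J(\mathsf M_1,\mathsf M_2)$. Let $\mathcal H=\ell^2(\mathbb N_0)$ with its standard orthonormal basis $\{|n\rangle\}_{n\ge 0}$. Let $\mathsf N$ be the photon number observable on $\mathbb N_0$, $\mathsf N(Y)=\sum_{n\in Y}|n\rangle\langle n|$, and let $\Phi$ be the canonical phase observable on $[0,2\pi)$ (with its Borel sets), $$\Phi(X)=\sum_{m,n=0}^\infty \frac1{2\pi}\int_X e^{i(m-n)\theta}\,d\theta\;|m\rangle\langle n| .$$ **Theorem.** The observables $\mathsf N$ and $\Phi$ are maximally incompatible, and their joint measurability degree exists and equals $1/2$. -/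

import Mathlib

open MeasureTheory Set
open scoped InnerProductSpace ENNReal

noncomputable section

namespace QuantumObservables

/-- An observable (normalized positive operator valued measure) with outcome space `Ω` on a
complex Hilbert space `H`; countable additivity is in the weak operator sense.  Only the values on
measurable sets matter. -/
structure Observable (Ω : Type*) [MeasurableSpace Ω]
    (H : Type*) [NormedAddCommGroup H] [InnerProductSpace ℂ H] where
  toFun : Set Ω → H →L[ℂ] H
  isPositive' : ∀ X, MeasurableSet X → (toFun X).IsPositive
  map_univ' : toFun univ = 1
  hasSum_iUnion' : ∀ X : ℕ → Set Ω, (∀ i, MeasurableSet (X i)) → Pairwise (Function.onFun Disjoint X) →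
    ∀ φ ψ : H, HasSum (fun i => ⟪φ, toFun (X i) ψ⟫_ℂ) ⟪φ, toFun (⋃ i, X i) ψ⟫_ℂ

section General

variable {Ω Ω₁ Ω₂ : Type*} [MeasurableSpace Ω] [MeasurableSpace Ω₁] [MeasurableSpace Ω₂]
  {H : Type*} [NormedAddCommGroup H] [InnerProductSpace ℂ H]

instance : CoeFun (Observable Ω H) (fun _ => Set Ω → H →L[ℂ] H) := ⟨Observable.toFun⟩

/-- A trivial observable: `T(X) = μ(X) 1` for some probability measure `μ`. -/
def Observable.IsTrivial (T : Observable Ω H) : Prop :=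
  ∃ μ : Measure Ω, IsProbabilityMeasure μ ∧
    ∀ X, MeasurableSet X → T X = ((μ.real X : ℝ) : ℂ) • (1 : H →L[ℂ] H)

/-- The convex combination `t M + (1 - t) T` of two observables. -/
def Observable.mix (t : ℝ) (ht : t ∈ Icc (0 : ℝ) 1) (M T : Observable Ω H) : Observable Ω H where
  toFun X := (t : ℂ) • M X + ((1 - t : ℝ) : ℂ) • T X
  isPositive' X hX :=
    ((M.isPositive' X hX).smul_of_nonneg (by exact_mod_cast ht.1)).add
      ((T.isPositive' X hX).smul_of_nonneg (by exact_mod_cast sub_nonneg.2 ht.2))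
  map_univ' := by
    rw [M.map_univ', T.map_univ', ← add_smul]
    simp
  hasSum_iUnion' X hX hd φ ψ := by
    have h := ((M.hasSum_iUnion' X hX hd φ ψ).mul_left (t : ℂ)).add
      ((T.hasSum_iUnion' X hX hd φ ψ).mul_left ((1 - t : ℝ) : ℂ))
    simpa only [add_apply, smul_apply, inner_add_right, inner_smul_right] using h

/-- `M₁` and `M₂` are jointly measurable: they are the margins of one observable on the product
outcome space. -/
def JointlyMeasurable (M₁ : Observable Ω₁ H) (M₂ : Observable Ω₂ H) : Prop :=
  ∃ M : Observable (Ω₁ × Ω₂) H,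
    (∀ X, MeasurableSet X → M (X ×ˢ univ) = M₁ X) ∧
    (∀ Y, MeasurableSet Y → M (univ ×ˢ Y) = M₂ Y)

/-- The joint measurability region `J(M₁, M₂) ⊆ [0,1] × [0,1]`. -/
def jointMeasurabilityRegion (M₁ : Observable Ω₁ H) (M₂ : Observable Ω₂ H) : Set (ℝ × ℝ) :=
  {p | ∃ (h₁ : p.1 ∈ Icc (0 : ℝ) 1) (h₂ : p.2 ∈ Icc (0 : ℝ) 1)
    (T₁ : Observable Ω₁ H) (T₂ : Observable Ω₂ H), T₁.IsTrivial ∧ T₂.IsTrivial ∧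
      JointlyMeasurable (Observable.mix p.1 h₁ M₁ T₁) (Observable.mix p.2 h₂ M₂ T₂)}

/-- Maximal incompatibility: the joint measurability region is exactly the triangle
`{(s, t) ∈ [0,1] × [0,1] | s + t ≤ 1}`. -/
def MaximallyIncompatible (M₁ : Observable Ω₁ H) (M₂ : Observable Ω₂ H) : Prop :=
  jointMeasurabilityRegion M₁ M₂ =
    {p : ℝ × ℝ | p.1 ∈ Icc (0 : ℝ) 1 ∧ p.2 ∈ Icc (0 : ℝ) 1 ∧ p.1 + p.2 ≤ 1}

/-- `d` is the joint measurability degree of `M₁` and `M₂`: the greatest `t ∈ [0,1]` such that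
`(t, t)` lies in the joint measurability region. -/
def IsJointMeasurabilityDegree (M₁ : Observable Ω₁ H) (M₂ : Observable Ω₂ H) (d : ℝ) : Prop :=
  IsGreatest {t : ℝ | (t, t) ∈ jointMeasurabilityRegion M₁ M₂} d

end General

/-! ### The number observable -/

/-- The Hilbert space `ℓ²(ℕ₀)`; the number state `|n⟩` is `lp.single 2 n 1`. -/
abbrev FockSpace : Type := lp (fun _ : ℕ => ℂ) 2

/-- The projection `∑_{n ∈ Y} |n⟩⟨n|`. -/
def numberOp (Y : Set ℕ) : FockSpace →L[ℂ] FockSpace :=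
  LinearMap.mkContinuous
    { toFun := fun x => ⟨Y.indicator x, (lp.memℓp x).mono' fun n => norm_indicator_le_norm_self x n⟩
      map_add' := fun x y => by
        ext n
        exact congrFun (indicator_add Y x y) n
      map_smul' := fun c x => by
        ext n
        exact congrFun (indicator_const_smul Y c x) n }
    1 fun x => by
      rw [one_mul]
      exact lp.norm_mono (by norm_num) fun n => norm_indicator_le_norm_self x n

theorem numberOp_apply (Y : Set ℕ) (x : FockSpace) (n : ℕ) :
    numberOp Y x n = Y.indicator x n := rfl

theorem integrable_inner_count (x y : FockSpace) :
    Integrable (fun n => ⟪x n, y n⟫_ℂ) (Measure.count : Measure ℕ) :=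
  integrable_count_iff.2 (lp.summable_inner (𝕜 := ℂ) x y).norm

theorem inner_numberOp (Y : Set ℕ) (x y : FockSpace) :
    ⟪x, numberOp Y y⟫_ℂ = ∫ n in Y, ⟪x n, y n⟫_ℂ ∂Measure.count := by
  have hi : Integrable (fun n => ⟪x n, y n⟫_ℂ) (Measure.count : Measure ℕ) :=
    integrable_inner_count x y
  rw [← integral_indicator (MeasurableSet.of_discrete), integral_countable]
  · rw [lp.inner_eq_tsum]
    refine tsum_congr fun n => ?_
    by_cases h : n ∈ Y <;> simp [numberOp_apply, h]
  · exact hi.indicator MeasurableSet.of_discrete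

/-- The photon number observable `N(Y) = ∑_{n ∈ Y} |n⟩⟨n|` with outcome space `ℕ₀`. -/
def numberObservable : Observable ℕ FockSpace where
  toFun := numberOp
  isPositive' Y _ := by
    have h : numberOp Y = ContinuousLinearMap.adjoint (numberOp Y) ∘L numberOp Y := by
      refine ContinuousLinearMap.ext fun y => ext_inner_left ℂ fun x => ?_
      rw [ContinuousLinearMap.comp_apply, ContinuousLinearMap.adjoint_inner_right,
        lp.inner_eq_tsum, lp.inner_eq_tsum]
      refine tsum_congr fun n => ?_
      by_cases h : n ∈ Y <;> simp [numberOp_apply, h]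
    rw [h]
    exact ContinuousLinearMap.isPositive_adjoint_comp_self _
  map_univ' := by
    ext x n
    simp [numberOp_apply]
  hasSum_iUnion' Y hY hd x y := by
    simp only [inner_numberOp]
    exact hasSum_integral_iUnion hY hd
      (integrable_inner_count x y).integrableOn

/-! ### The canonical phase observable -/

/-- The interval `[0, 2π)` with its Borel `σ`-algebra. -/
abbrev PhaseSpace : Type := Ico (0 : ℝ) (2 * Real.pi)

/-- The uniform probability measure `dθ / 2π` on `[0, 2π)`. -/
def phaseMeasure : Measure PhaseSpace := ENNReal.ofReal (1 / (2 * Real.pi)) • Measure.comap Subtype.val (volume : Measure ℝ)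

theorem measurableEmbedding_phase : MeasurableEmbedding (Subtype.val : PhaseSpace → ℝ) :=
  MeasurableEmbedding.subtype_coe measurableSet_Ico

instance : IsProbabilityMeasure phaseMeasure := ⟨by
  rw [phaseMeasure, Measure.smul_apply, measurableEmbedding_phase.comap_apply, image_univ,
    Subtype.range_coe, Real.volume_Ico, smul_eq_mul, ← ENNReal.ofReal_mul (by positivity)]
  have hpi : Real.pi ≠ 0 := Real.pi_ne_zero
  have : 1 / (2 * Real.pi) * (2 * Real.pi - 0) = 1 := by field_simp; ring
  rw [this, ENNReal.ofReal_one]⟩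

/-- The function `θ ↦ e^{-inθ}` on `[0, 2π)`. -/
def phaseChar (n : ℕ) (θ : PhaseSpace) : ℂ := Complex.exp (-(n * (θ : ℝ) * Complex.I))

theorem memLp_phaseChar (n : ℕ) : MemLp (phaseChar n) 2 phaseMeasure := by
  refine MemLp.of_bound (C := 1) ?_ (Filter.Eventually.of_forall fun θ => ?_)
  · have : Measurable (phaseChar n) := by unfold phaseChar; fun_prop
    exact this.aestronglyMeasurable
  · have : -((n : ℂ) * ((θ : ℝ) : ℂ) * Complex.I) = ((-(n * θ : ℝ) : ℝ) : ℂ) * Complex.I := by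
      push_cast; ring
    rw [phaseChar, this, Complex.norm_exp_ofReal_mul_I]

theorem inner_phaseChar (m n : ℕ) (θ : PhaseSpace) :
    ⟪phaseChar m θ, phaseChar n θ⟫_ℂ = Complex.exp (Complex.I * ((m : ℂ) - n) * (θ : ℝ)) := by
  rw [RCLike.inner_apply, phaseChar, phaseChar, ← Complex.exp_conj, ← Complex.exp_add]
  congr 1
  simp
  ring

theorem setIntegral_phaseMeasure (X : Set PhaseSpace) (f : ℝ → ℂ) :
    ∫ θ in X, f θ ∂phaseMeasure =
      1 / (2 * Real.pi) * ∫ θ in (Subtype.val '' X : Set ℝ), f θ := by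
  have h := measurableEmbedding_phase
  have hX : (Subtype.val ⁻¹' (Subtype.val '' X : Set ℝ) : Set PhaseSpace) = X :=
    preimage_image_eq X Subtype.val_injective
  have hm : (volume : Measure ℝ).restrict (Subtype.val '' X) =
      (((volume : Measure ℝ).comap Subtype.val).restrict X).map
        (Subtype.val : PhaseSpace → ℝ) := by
    have h2 := h.restrict_map ((volume : Measure ℝ).comap Subtype.val) (Subtype.val '' X)
    rw [hX] at h2
    rw [← h2, h.map_comap, Subtype.range_coe,
      Measure.restrict_restrict_of_subset]
    rintro _ ⟨θ, -, rfl⟩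
    exact θ.2
  rw [hm, h.integral_map, phaseMeasure, Measure.restrict_smul, integral_smul_measure,
    ENNReal.toReal_ofReal (by positivity)]
  simp [Complex.real_smul]

theorem orthonormal_phaseChar :
    Orthonormal ℂ (fun n : ℕ => (memLp_phaseChar n).toLp (phaseChar n)) := by
  rw [orthonormal_iff_ite]
  intro m n
  have h1 : ⟪(memLp_phaseChar m).toLp (phaseChar m), (memLp_phaseChar n).toLp (phaseChar n)⟫_ℂ =
      ∫ θ in (univ : Set PhaseSpace), Complex.exp (Complex.I * ((m : ℂ) - n) * (θ : ℝ))
        ∂phaseMeasure := by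
    rw [L2.inner_def, Measure.restrict_univ]
    refine integral_congr_ae ?_
    filter_upwards [(memLp_phaseChar m).coeFn_toLp, (memLp_phaseChar n).coeFn_toLp] with θ h h'
    rw [h, h', inner_phaseChar]
  rw [h1, setIntegral_phaseMeasure univ
    (fun θ : ℝ => Complex.exp (Complex.I * ((m : ℂ) - n) * θ)), image_univ, Subtype.range_coe,
    integral_Ico_eq_integral_Ioo, ← integral_Ioc_eq_integral_Ioo,
    ← intervalIntegral.integral_of_le (by positivity)]
  by_cases hmn : m = n
  · subst hmn
    have hpi : (Real.pi : ℂ) ≠ 0 := by exact_mod_cast Real.pi_ne_zero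
    simp
    field_simp
  · have hc : Complex.I * ((m : ℂ) - n) ≠ 0 :=
      mul_ne_zero Complex.I_ne_zero (sub_ne_zero.2 (by exact_mod_cast hmn))
    rw [integral_exp_mul_complex hc, if_neg hmn]
    have : Complex.exp (Complex.I * ((m : ℂ) - n) * ((2 * Real.pi : ℝ) : ℂ)) = 1 := by
      rw [Complex.exp_eq_one_iff]
      exact ⟨(m : ℤ) - n, by push_cast; ring⟩
    rw [this]
    simp

/-- The isometry `ℓ²(ℕ₀) → L²([0, 2π), dθ/2π)`, `|n⟩ ↦ e^{-inθ}`. -/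
def phaseIsometry : FockSpace →ₗᵢ[ℂ] Lp ℂ 2 phaseMeasure :=
  orthonormal_phaseChar.orthogonalFamily.linearIsometry

/-- `φ ↦ (phaseIsometry φ)` restricted to `X`. -/
def phaseRestrict (X : Set PhaseSpace) : FockSpace →L[ℂ] Lp ℂ 2 (phaseMeasure.restrict X) :=
  LpToLpRestrictCLM PhaseSpace ℂ ℂ phaseMeasure 2 X ∘L phaseIsometry.toContinuousLinearMap

/-- `Φ(X)`, the bounded operator with `⟨φ, Φ(X) ψ⟩ = ∫_X conj(φ^(θ)) ψ^(θ) dθ/2π`, where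
`φ^(θ) = ∑ n, φ n e^{-inθ}`; see `phaseOp_matrix` for its matrix elements. -/
def phaseOp (X : Set PhaseSpace) : FockSpace →L[ℂ] FockSpace :=
  ContinuousLinearMap.adjoint (phaseRestrict X) ∘L phaseRestrict X

theorem inner_phaseOp (X : Set PhaseSpace) (φ ψ : FockSpace) :
    ⟪φ, phaseOp X ψ⟫_ℂ = ∫ θ in X, ⟪phaseIsometry φ θ, phaseIsometry ψ θ⟫_ℂ ∂phaseMeasure := by
  rw [phaseOp, ContinuousLinearMap.comp_apply, ContinuousLinearMap.adjoint_inner_right,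
    L2.inner_def]
  refine integral_congr_ae ?_
  filter_upwards [LpToLpRestrictCLM_coeFn ℂ X (phaseIsometry φ),
    LpToLpRestrictCLM_coeFn ℂ X (phaseIsometry ψ)] with θ h h'
  exact congrArg₂ _ h h'

/-- The matrix elements `⟨m| Φ(X) |n⟩ = (1/2π) ∫_X e^{i(m-n)θ} dθ`, which determine the bounded
operator `Φ(X)`. -/
theorem phaseOp_matrix (X : Set PhaseSpace) (m n : ℕ) :
    ⟪(lp.single 2 m (1 : ℂ) : FockSpace), phaseOp X (lp.single 2 n (1 : ℂ) : FockSpace)⟫_ℂ =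
      1 / (2 * Real.pi) * ∫ θ in (Subtype.val '' X : Set ℝ),
        Complex.exp (Complex.I * ((m : ℂ) - n) * θ) := by
  have h : ∀ k : ℕ, phaseIsometry (lp.single 2 k (1 : ℂ) : FockSpace) =
      (memLp_phaseChar k).toLp (phaseChar k) := fun k => by
    rw [phaseIsometry, OrthogonalFamily.linearIsometry_apply_single]
    simp
  rw [inner_phaseOp, h, h, ← setIntegral_phaseMeasure X
    (fun θ : ℝ => Complex.exp (Complex.I * ((m : ℂ) - n) * θ))]
  refine integral_congr_ae (ae_restrict_of_ae ?_)
  filter_upwards [(memLp_phaseChar m).coeFn_toLp, (memLp_phaseChar n).coeFn_toLp] with θ h h'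
  rw [h, h', inner_phaseChar]

/-- The canonical phase observable
`Φ(X) = ∑_{m,n} (1/2π) ∫_X e^{i(m-n)θ} dθ |m⟩⟨n|` with outcome space `[0, 2π)`. -/
def phaseObservable : Observable PhaseSpace FockSpace where
  toFun := phaseOp
  isPositive' X _ := ContinuousLinearMap.isPositive_adjoint_comp_self _
  map_univ' := by
    refine ContinuousLinearMap.ext fun ψ => ext_inner_left ℂ fun φ => ?_
    rw [inner_phaseOp, Measure.restrict_univ, ← L2.inner_def, LinearIsometry.inner_map_map]
    rfl
  hasSum_iUnion' X hX hd φ ψ := by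
    simp only [inner_phaseOp]
    exact hasSum_integral_iUnion hX hd (L2.integrable_inner (𝕜 := ℂ) _ _).integrableOn

end QuantumObservables

end

/-!
Suppose `M` has margins `s A + (1 - s) p` and `t B + (1 - t) q`, with `A {n} = |eₙ⟩⟨eₙ|`. On a cell
`{n} × Y`, the part of a unit vector `ψ` orthogonal to `eₙ` meets only the noise `(1 - s) pₙ`, so
Young's inequality with weight `c > 0` gives
`⟨ψ, M({n} × Y) ψ⟩ ≤ (1 + c⁻¹) |⟨eₙ, ψ⟩|² ⟨eₙ, M({n} × Y) eₙ⟩ + (1 + c) (1 - s) pₙ`.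
Take `r` unit vectors with the same numbers `|⟨eₙ, ψ⟩|²` that `B` localizes, up to `ε`, in pairwise
disjoint sets `Y`. Summing over `n` and over these vectors, the first terms contribute at most
`1 + c⁻¹`, because the cells `{n} × Y` are disjoint, whence
`r t (1 - ε) ≤ (1 + c⁻¹) + r (1 + c) (1 - s)`. Letting `r → ∞` and then `ε, c → 0` gives
`t ≤ 1 - s`. For number and phase, the vectors are truncated phase states at distinct points of the
circle. Conversely, every `(s, t)` with `s + t ≤ 1` is reached by tossing a coin to decide which of
the two observables to measure.
-/

open Filter Topology

noncomputable section

namespace QuantumObservables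

section Analysis

theorem hasSum_measureReal_iUnion {α ι : Type*} [MeasurableSpace α] [Countable ι] {μ : Measure α}
    [IsFiniteMeasure μ] {X : ι → Set α} (hX : ∀ i, MeasurableSet (X i))
    (hd : Pairwise (Function.onFun Disjoint X)) :
    HasSum (fun i => μ.real (X i)) (μ.real (⋃ i, X i)) := by
  simpa using hasSum_integral_iUnion hX hd (integrable_const (1 : ℝ)).integrableOn

theorem hasSum_measureReal_singleton_prod {α ι : Type*} [MeasurableSpace α] [MeasurableSpace ι]
    [MeasurableSingletonClass ι] [Countable ι] (μ : Measure (ι × α)) [IsFiniteMeasure μ]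
    {Y : Set α} (hY : MeasurableSet Y) :
    HasSum (fun n => μ.real ({n} ×ˢ Y)) (μ.real (univ ×ˢ Y)) := by
  rw [← iUnion_of_singleton ι, iUnion_prod_const]
  exact hasSum_measureReal_iUnion (fun n => (MeasurableSet.singleton n).prod hY)
    fun _ _ h => Disjoint.set_prod_left (disjoint_singleton.2 h) _ _

theorem hasSum_measureReal_singleton {ι : Type*} [MeasurableSpace ι] [MeasurableSingletonClass ι]
    [Countable ι] (μ : Measure ι) [IsFiniteMeasure μ] :
    HasSum (fun n => μ.real {n}) (μ.real univ) := by
  rw [← iUnion_of_singleton ι]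
  exact hasSum_measureReal_iUnion (fun n => .singleton n) fun _ _ h => disjoint_singleton.2 h

theorem norm_geom_sum_mul_norm_sub_one_le {K : Type*} [NormedDivisionRing K] {z : K}
    (hz : ‖z‖ ≤ 1) (m : ℕ) : ‖∑ n ∈ Finset.range m, z ^ n‖ * ‖z - 1‖ ≤ 2 := by
  rw [← norm_mul, geom_sum_mul]
  calc ‖z ^ m - 1‖ ≤ ‖z‖ ^ m + 1 := by simpa using norm_sub_le (z ^ m) 1
    _ ≤ 1 + 1 := by gcongr; exact pow_le_one₀ (norm_nonneg z) hz
    _ = 2 := one_add_one_eq_two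

theorem norm_sub_inner_smul_le {𝕜 E : Type*} [RCLike 𝕜] [SeminormedAddCommGroup E]
    [InnerProductSpace 𝕜 E] {e : E} (he : ‖e‖ = 1) (x : E) : ‖x - ⟪e, x⟫_𝕜 • e‖ ≤ ‖x‖ := by
  have orthogonal : ⟪⟪e, x⟫_𝕜 • e, x - ⟪e, x⟫_𝕜 • e⟫_𝕜 = 0 := by
    rw [inner_smul_left, inner_sub_right, inner_smul_right, inner_self_eq_norm_sq_to_K, he]
    simp
  have pythagoras := norm_add_sq_eq_norm_sq_add_norm_sq_of_inner_eq_zero _ _ orthogonal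
  rw [add_sub_cancel] at pythagoras
  refine nonneg_le_nonneg_of_sq_le_sq (norm_nonneg x) ?_
  linarith [mul_self_nonneg ‖⟪e, x⟫_𝕜 • e‖]

end Analysis

variable {Ω Ω₁ Ω₂ ι : Type*} [MeasurableSpace Ω] [MeasurableSpace Ω₁] [MeasurableSpace Ω₂]
  [MeasurableSpace ι] {H : Type*} [NormedAddCommGroup H] [InnerProductSpace ℂ H]

namespace Observable

theorem map_empty (M : Observable Ω H) : M ∅ = 0 := by
  refine ContinuousLinearMap.ext fun ψ => ext_inner_left ℂ fun φ => ?_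
  have h := M.hasSum_iUnion' (fun _ => ∅) (fun _ => .empty) (fun _ _ _ => disjoint_bot_left) φ ψ
  rw [(summable_const_iff _).1 h.summable, zero_apply, inner_zero_right]

theorem re_inner_nonneg (M : Observable Ω H) (ψ : H) {X : Set Ω} (hX : MeasurableSet X) :
    0 ≤ (⟪ψ, M X ψ⟫_ℂ).re :=
  (M.isPositive' X hX).re_inner_nonneg_right ψ

section Distribution

/-- The outcome distribution `X ↦ ⟨ψ, M(X) ψ⟩` of `M` in the state `ψ`. The vector `ψ` need not be
normalized, and the total mass is `‖ψ‖ ^ 2`. -/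
def distribution (M : Observable Ω H) (ψ : H) : Measure Ω :=
  Measure.ofMeasurable (fun X _ => ENNReal.ofReal (⟪ψ, M X ψ⟫_ℂ).re)
    (by simp [M.map_empty])
    (fun X hX hd => by
      have h := Complex.hasSum_re (M.hasSum_iUnion' X hX hd ψ ψ)
      rw [← h.tsum_eq]
      exact ENNReal.ofReal_tsum_of_nonneg (fun i => M.re_inner_nonneg ψ (hX i)) h.summable)

theorem distribution_apply (M : Observable Ω H) (ψ : H) {X : Set Ω} (hX : MeasurableSet X) :
    M.distribution ψ X = ENNReal.ofReal (⟪ψ, M X ψ⟫_ℂ).re :=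
  Measure.ofMeasurable_apply X hX

theorem distribution_real (M : Observable Ω H) (ψ : H) {X : Set Ω} (hX : MeasurableSet X) :
    (M.distribution ψ).real X = (⟪ψ, M X ψ⟫_ℂ).re := by
  rw [measureReal_def, M.distribution_apply ψ hX, ENNReal.toReal_ofReal (M.re_inner_nonneg ψ hX)]

instance (M : Observable Ω H) (ψ : H) : IsFiniteMeasure (M.distribution ψ) :=
  ⟨by rw [M.distribution_apply ψ .univ]; exact ENNReal.ofReal_lt_top⟩

theorem distribution_real_univ (M : Observable Ω H) (ψ : H) :
    (M.distribution ψ).real univ = ‖ψ‖ ^ 2 := by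
  rw [M.distribution_real ψ .univ, M.map_univ', one_apply_eq_self]
  exact inner_self_eq_norm_sq (𝕜 := ℂ) ψ

theorem distribution_real_congr {M₁ : Observable Ω₁ H} {M₂ : Observable Ω₂ H} {X : Set Ω₁}
    {Y : Set Ω₂} (hX : MeasurableSet X) (hY : MeasurableSet Y) (h : M₁ X = M₂ Y) (ψ : H) :
    (M₁.distribution ψ).real X = (M₂.distribution ψ).real Y := by
  rw [M₁.distribution_real ψ hX, M₂.distribution_real ψ hY, h]

theorem distribution_real_smul (M : Observable Ω H) (a : ℂ) (ψ : H) {X : Set Ω}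
    (hX : MeasurableSet X) :
    (M.distribution (a • ψ)).real X = ‖a‖ ^ 2 * (M.distribution ψ).real X := by
  simp only [M.distribution_real _ hX]
  rw [map_smul, inner_smul_left, inner_smul_right, ← mul_assoc, mul_comm ((starRingEnd ℂ) a),
    Complex.mul_conj, Complex.re_ofReal_mul, Complex.normSq_eq_norm_sq]

theorem distribution_real_add_le (M : Observable Ω H) (φ ψ : H) {X : Set Ω}
    (hX : MeasurableSet X) {c : ℝ} (hc : 0 < c) :
    (M.distribution (φ + ψ)).real X ≤
      (1 + c⁻¹) * (M.distribution φ).real X + (1 + c) * (M.distribution ψ).real X := by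
  simp only [M.distribution_real _ hX, map_add, inner_add_left, inner_add_right, Complex.add_re]
  have cross : c * ((⟪φ, M X ψ⟫_ℂ).re + (⟪ψ, M X φ⟫_ℂ).re) ≤
      (⟪φ, M X φ⟫_ℂ).re + c * (c * (⟪ψ, M X ψ⟫_ℂ).re) := by
    have h := M.re_inner_nonneg (φ - (c : ℂ) • ψ) hX
    simp only [map_sub, map_smul, inner_sub_left, inner_sub_right, inner_smul_left,
      inner_smul_right, Complex.sub_re, Complex.conj_ofReal, Complex.re_ofReal_mul] at h
    linarith
  have young : (⟪φ, M X ψ⟫_ℂ).re + (⟪ψ, M X φ⟫_ℂ).re ≤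
      c⁻¹ * (⟪φ, M X φ⟫_ℂ).re + c * (⟪ψ, M X ψ⟫_ℂ).re := by
    rw [← mul_le_mul_iff_right₀ hc, mul_add c (c⁻¹ * _), mul_inv_cancel_left₀ hc.ne']
    exact cross
  linarith

theorem distribution_mix_real {s : ℝ} (hs : s ∈ Icc (0 : ℝ) 1) (M T : Observable Ω H) (ψ : H)
    {X : Set Ω} (hX : MeasurableSet X) :
    ((mix s hs M T).distribution ψ).real X =
      s * (M.distribution ψ).real X + (1 - s) * (T.distribution ψ).real X := by
  simp only [distribution_real _ _ hX, mix, add_apply, smul_apply, inner_add_right,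
    inner_smul_right, Complex.add_re, Complex.re_ofReal_mul]

theorem IsTrivial.exists_distribution_real {T : Observable Ω H} (hT : T.IsTrivial) :
    ∃ p : Measure Ω, IsProbabilityMeasure p ∧ ∀ (ψ : H) (X : Set Ω), MeasurableSet X →
      (T.distribution ψ).real X = p.real X * ‖ψ‖ ^ 2 := by
  obtain ⟨p, hp, h⟩ := hT
  refine ⟨p, hp, fun ψ X hX => ?_⟩
  rw [T.distribution_real ψ hX, h X hX, smul_apply, one_apply_eq_self, inner_smul_right,
    Complex.re_ofReal_mul]
  exact congrArg _ (inner_self_eq_norm_sq (𝕜 := ℂ) ψ)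

end Distribution

/-- The image of an observable under a measurable map of outcome spaces. -/
def map (f : Ω₁ → Ω₂) (hf : Measurable f) (M : Observable Ω₁ H) : Observable Ω₂ H where
  toFun X := M (f ⁻¹' X)
  isPositive' X hX := M.isPositive' _ (hf hX)
  map_univ' := M.map_univ'
  hasSum_iUnion' X hX hd φ ψ := by
    rw [preimage_iUnion]
    exact M.hasSum_iUnion' _ (fun i => hf (hX i)) (fun i j hij => (hd hij).preimage f) φ ψ

theorem isTrivial_map_const (M : Observable Ω₁ H) (x : Ω₂) :
    (M.map (fun _ => x) measurable_const).IsTrivial := by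
  refine ⟨Measure.dirac x, inferInstance, fun X hX => ?_⟩
  change M ((fun _ => x) ⁻¹' X) = _
  by_cases hx : x ∈ X <;>
    simp [measureReal_def, Measure.dirac_apply' x hX, hx, M.map_univ', M.map_empty]

theorem mix_mix {s t u : ℝ} (hs : s ∈ Icc (0 : ℝ) 1) (ht : t ∈ Icc (0 : ℝ) 1)
    (hu : u ∈ Icc (0 : ℝ) 1) (hst : s * t = u) (M T : Observable Ω H) :
    mix s hs (mix t ht M T) T = mix u hu M T := by
  subst hst
  simp only [mix, Observable.mk.injEq]
  funext X
  push_cast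
  module

end Observable

section Triangle

/-- Tossing a coin to decide which of the two observables to measure, and reporting a fixed outcome
for the other one. -/
theorem jointlyMeasurable_mix_map_const (M₁ : Observable Ω₁ H) (M₂ : Observable Ω₂ H)
    (x : Ω₁) (y : Ω₂) {s : ℝ} (hs : s ∈ Icc (0 : ℝ) 1) (hs' : 1 - s ∈ Icc (0 : ℝ) 1) :
    JointlyMeasurable (.mix s hs M₁ (M₂.map (fun _ => x) measurable_const))
      (.mix (1 - s) hs' M₂ (M₁.map (fun _ => y) measurable_const)) := by
  refine ⟨.mix s hs (M₁.map (·, y) measurable_prodMk_right)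
    (M₂.map (x, ·) measurable_prodMk_left), fun X _ => ?_, fun Y _ => ?_⟩
  · simp only [prod_univ]
    rfl
  · simp only [univ_prod, Observable.mix, sub_sub_cancel]
    exact add_comm _ _

theorem mem_jointMeasurabilityRegion_of_add_le_one [Nonempty Ω₁] [Nonempty Ω₂]
    (M₁ : Observable Ω₁ H) (M₂ : Observable Ω₂ H) {s t : ℝ}
    (hs : s ∈ Icc (0 : ℝ) 1) (ht : t ∈ Icc (0 : ℝ) 1) (hst : s + t ≤ 1) :
    (s, t) ∈ jointMeasurabilityRegion M₁ M₂ := by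
  obtain ⟨x⟩ := ‹Nonempty Ω₁›
  obtain ⟨y⟩ := ‹Nonempty Ω₂›
  have hs' : 1 - s ∈ Icc (0 : ℝ) 1 := ⟨sub_nonneg.2 hs.2, sub_le_self 1 hs.1⟩
  obtain ⟨τ, hτ, hτt⟩ : ∃ τ ∈ Icc (0 : ℝ) 1, (1 - s) * τ = t :=
    ⟨t / (1 - s), ⟨div_nonneg ht.1 hs'.1, div_le_one_of_le₀ (by linarith) hs'.1⟩,
      mul_div_cancel_of_imp' fun h => le_antisymm (by linarith) ht.1⟩
  have joint := jointlyMeasurable_mix_map_const M₁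
    (.mix τ hτ M₂ (M₁.map (fun _ => y) measurable_const)) x y hs hs'
  rw [Observable.mix_mix hs' hτ ht hτt] at joint
  exact ⟨hs, ht, _, _, Observable.isTrivial_map_const _ x, Observable.isTrivial_map_const _ y,
    joint⟩

theorem MaximallyIncompatible.isJointMeasurabilityDegree {M₁ : Observable Ω₁ H}
    {M₂ : Observable Ω₂ H} (h : MaximallyIncompatible M₁ M₂) :
    IsJointMeasurabilityDegree M₁ M₂ (1 / 2) := by
  rw [MaximallyIncompatible] at h
  rw [IsJointMeasurabilityDegree, h]
  refine ⟨by norm_num, fun t ht => ?_⟩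
  have : t + t ≤ 1 := ht.2.2
  linarith

end Triangle

section Criterion

/-- Every singleton outcome of `A` is measured by a one-dimensional projection, as for the
observable `∑ n, |eₙ⟩⟨eₙ|` of an orthonormal basis. -/
def Observable.HasRankOneAtoms (A : Observable ι H) : Prop :=
  ∀ n, ∃ e : H, ‖e‖ = 1 ∧ A {n} = InnerProductSpace.rankOne ℂ e e

/-- `A` is blind to `B`: arbitrarily many states with the same `A`-statistics are distinguished by
`B` with an arbitrarily small probability of error. -/
def Observable.IsBlindTo (A : Observable ι H) (B : Observable Ω H) : Prop :=
  ∀ (r : ℕ) (ε : ℝ), 0 < ε → ∃ (ψ : Fin r → H) (Y : Fin r → Set Ω),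
    (∀ j, ‖ψ j‖ = 1) ∧ (∀ i j, A.distribution (ψ i) = A.distribution (ψ j)) ∧
    (∀ j, MeasurableSet (Y j)) ∧ Pairwise (Function.onFun Disjoint Y) ∧
    ∀ j, 1 - ε ≤ (B.distribution (ψ j)).real (Y j)

theorem Observable.distribution_real_singleton_of_rankOne [MeasurableSingletonClass ι]
    {A : Observable ι H} {n : ι} {e : H} (hA : A {n} = InnerProductSpace.rankOne ℂ e e) (ψ : H) :
    (A.distribution ψ).real {n} = ‖⟪e, ψ⟫_ℂ‖ ^ 2 := by
  rw [A.distribution_real ψ (.singleton n), hA, InnerProductSpace.rankOne_apply, inner_smul_right,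
    ← inner_conj_symm ψ e, Complex.mul_conj, Complex.ofReal_re, Complex.normSq_eq_norm_sq]

variable [MeasurableSingletonClass ι] {s t : ℝ} {A T : Observable ι H}
  {M : Observable (ι × Ω) H}

/-- The component of `ψ` orthogonal to `e` is not seen by `A {n}`, so on the cell `{n} × Y` it only
meets the trivial noise. -/
theorem distribution_real_singleton_prod_le (hs : s ∈ Icc (0 : ℝ) 1) {n : ι} {e : H}
    (he : ‖e‖ = 1) (hA : A {n} = InnerProductSpace.rankOne ℂ e e) {p : Measure ι}
    (hp : ∀ φ : H, (T.distribution φ).real {n} = p.real {n} * ‖φ‖ ^ 2)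
    (hM : M ({n} ×ˢ univ) = Observable.mix s hs A T {n}) {ψ : H} (hψ : ‖ψ‖ = 1)
    {Y : Set Ω} (hY : MeasurableSet Y) {c : ℝ} (hc : 0 < c) :
    (M.distribution ψ).real ({n} ×ˢ Y) ≤
      (1 + c⁻¹) * ((A.distribution ψ).real {n} * (M.distribution e).real ({n} ×ˢ Y)) +
        (1 + c) * ((1 - s) * p.real {n}) := by
  have hn : MeasurableSet {n} := .singleton n
  set φ := ψ - ⟪e, ψ⟫_ℂ • e with hφ
  have hφA : (A.distribution φ).real {n} = 0 := by
    rw [Observable.distribution_real_singleton_of_rankOne hA, hφ, inner_sub_right,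
      inner_smul_right, inner_self_eq_norm_sq_to_K, he]
    simp
  have noise : (M.distribution φ).real ({n} ×ˢ Y) ≤ (1 - s) * p.real {n} := by
    have hs' : 0 ≤ 1 - s := sub_nonneg.2 hs.2
    calc (M.distribution φ).real ({n} ×ˢ Y) ≤ (M.distribution φ).real ({n} ×ˢ univ) :=
          measureReal_mono (prod_mono_right (subset_univ Y))
      _ = ((Observable.mix s hs A T).distribution φ).real {n} :=
          Observable.distribution_real_congr (hn.prod .univ) hn hM φ
      _ = (1 - s) * (p.real {n} * ‖φ‖ ^ 2) := by
          rw [Observable.distribution_mix_real hs A T φ hn, hφA, hp, mul_zero, zero_add]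
      _ ≤ (1 - s) * p.real {n} := by
          gcongr
          refine mul_le_of_le_one_right measureReal_nonneg (pow_le_one₀ (norm_nonneg φ) ?_)
          exact (norm_sub_inner_smul_le he ψ).trans_eq hψ
  calc (M.distribution ψ).real ({n} ×ˢ Y)
      = (M.distribution (⟪e, ψ⟫_ℂ • e + φ)).real ({n} ×ˢ Y) := by rw [hφ, add_sub_cancel]
    _ ≤ (1 + c⁻¹) * (M.distribution (⟪e, ψ⟫_ℂ • e)).real ({n} ×ˢ Y) +
          (1 + c) * (M.distribution φ).real ({n} ×ˢ Y) :=
        M.distribution_real_add_le _ φ (hn.prod hY) hc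
    _ ≤ _ := by
        rw [M.distribution_real_smul _ e (hn.prod hY),
          ← Observable.distribution_real_singleton_of_rankOne hA]
        gcongr

theorem sum_distribution_real_singleton_prod_le {κ : Type*} [Fintype κ] (hs : s ∈ Icc (0 : ℝ) 1)
    {n : ι} {e : H} (he : ‖e‖ = 1) (hA : A {n} = InnerProductSpace.rankOne ℂ e e) {p : Measure ι}
    (hp : ∀ φ : H, (T.distribution φ).real {n} = p.real {n} * ‖φ‖ ^ 2)
    (hM : M ({n} ×ˢ univ) = Observable.mix s hs A T {n})
    {ψ : κ → H} (hψ : ∀ j, ‖ψ j‖ = 1) {ν : Measure ι} (hν : ∀ j, A.distribution (ψ j) = ν)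
    {Y : κ → Set Ω} (hY : ∀ j, MeasurableSet (Y j)) (hd : Pairwise (Function.onFun Disjoint Y))
    {c : ℝ} (hc : 0 < c) :
    ∑ j, (M.distribution (ψ j)).real ({n} ×ˢ Y j) ≤
      (1 + c⁻¹) * ν.real {n} + (1 + c) * (1 - s) * Fintype.card κ * p.real {n} := by
  have cells_le_one : ∑ j, (M.distribution e).real ({n} ×ˢ Y j) ≤ 1 := by
    rw [← one_pow 2, ← he, ← M.distribution_real_univ]
    exact sum_measureReal_le_measureReal_univ (fun j _ => (MeasurableSet.singleton n).prod (hY j))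
      fun j _ k _ hjk => Disjoint.set_prod_right (hd hjk) _ _
  calc ∑ j, (M.distribution (ψ j)).real ({n} ×ˢ Y j)
      ≤ ∑ j, ((1 + c⁻¹) * (ν.real {n} * (M.distribution e).real ({n} ×ˢ Y j)) +
          (1 + c) * ((1 - s) * p.real {n})) := by
        gcongr with j
        rw [← hν j]
        exact distribution_real_singleton_prod_le hs he hA hp hM (hψ j) (hY j) hc
    _ = (1 + c⁻¹) * (ν.real {n} * ∑ j, (M.distribution e).real ({n} ×ˢ Y j)) +
          (1 + c) * (1 - s) * Fintype.card κ * p.real {n} := by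
        rw [Finset.sum_add_distrib, ← Finset.mul_sum, ← Finset.mul_sum, Finset.sum_const,
          Finset.card_univ, nsmul_eq_mul]
        ring
    _ ≤ _ := by
        gcongr
        exact mul_le_of_le_one_right measureReal_nonneg cells_le_one

theorem sum_distribution_real_univ_prod_le [Countable ι] {κ : Type*} [Fintype κ]
    (hA : A.HasRankOneAtoms) (hT : T.IsTrivial) (hs : s ∈ Icc (0 : ℝ) 1)
    (hM : ∀ X, MeasurableSet X → M (X ×ˢ univ) = Observable.mix s hs A T X)
    {ψ : κ → H} (hψ : ∀ j, ‖ψ j‖ = 1) (hAψ : ∀ i j, A.distribution (ψ i) = A.distribution (ψ j))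
    {Y : κ → Set Ω} (hY : ∀ j, MeasurableSet (Y j)) (hd : Pairwise (Function.onFun Disjoint Y))
    {c : ℝ} (hc : 0 < c) :
    ∑ j, (M.distribution (ψ j)).real (univ ×ˢ Y j) ≤
      (1 + c⁻¹) + (1 + c) * (1 - s) * Fintype.card κ := by
  cases isEmpty_or_nonempty κ with
  | inl _ =>
    rw [Fintype.sum_empty, Fintype.card_eq_zero, Nat.cast_zero, mul_zero, add_zero]
    positivity
  | inr hκ =>
    obtain ⟨i⟩ := hκ
    choose e he hAe using hA
    obtain ⟨p, _, hp⟩ := hT.exists_distribution_real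
    have outcome_le (n : ι) : ∑ j, (M.distribution (ψ j)).real ({n} ×ˢ Y j) ≤
        (1 + c⁻¹) * (A.distribution (ψ i)).real {n} +
          (1 + c) * (1 - s) * Fintype.card κ * p.real {n} :=
      sum_distribution_real_singleton_prod_le hs (he n) (hAe n) (fun φ => hp φ _ (.singleton n))
        (hM _ (.singleton n)) hψ (fun j => hAψ j i) hY hd hc
    have total_le := hasSum_le outcome_le
      (hasSum_sum fun j _ => hasSum_measureReal_singleton_prod (M.distribution (ψ j)) (hY j))
      (((hasSum_measureReal_singleton _).mul_left _).add
        ((hasSum_measureReal_singleton p).mul_left _))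
    rwa [Observable.distribution_real_univ, hψ, one_pow, mul_one, probReal_univ, mul_one]
      at total_le

theorem add_le_one_of_mem_jointMeasurabilityRegion [Countable ι] {B : Observable Ω H}
    (hA : A.HasRankOneAtoms) (hAB : A.IsBlindTo B)
    (hst : (s, t) ∈ jointMeasurabilityRegion A B) : s + t ≤ 1 := by
  obtain ⟨hs, ht, T₁, T₂, hT₁, -, M, hM₁, hM₂⟩ := hst
  have bound (c : ℝ) (hc : 0 < c) (r : ℕ) :
      t * (1 - c) * r ≤ (1 + c⁻¹) + (1 + c) * (1 - s) * r := by
    obtain ⟨ψ, Y, hψ, hAψ, hY, hd, hB⟩ := hAB r c hc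
    have cell_ge (j : Fin r) : t * (1 - c) ≤ (M.distribution (ψ j)).real (univ ×ˢ Y j) := by
      rw [Observable.distribution_real_congr (MeasurableSet.univ.prod (hY j)) (hY j)
        (hM₂ _ (hY j)), Observable.distribution_mix_real ht B T₂ _ (hY j)]
      exact le_add_of_le_of_nonneg (mul_le_mul_of_nonneg_left (hB j) ht.1)
        (mul_nonneg (sub_nonneg.2 ht.2) measureReal_nonneg)
    calc t * (1 - c) * r = ∑ _j : Fin r, t * (1 - c) := by simp [mul_comm]
      _ ≤ ∑ j, (M.distribution (ψ j)).real (univ ×ˢ Y j) := by gcongr with j; exact cell_ge j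
      _ ≤ _ := by
        simpa using sum_distribution_real_univ_prod_le hA hT₁ hs hM₁ hψ hAψ hY hd hc
  have bound_limit (c : ℝ) (hc : 0 < c) : t * (1 - c) ≤ (1 + c) * (1 - s) := by
    by_contra! h
    obtain ⟨r, hr⟩ := exists_nat_gt ((1 + c⁻¹) / (t * (1 - c) - (1 + c) * (1 - s)))
    rw [div_lt_iff₀ (sub_pos.2 h)] at hr
    linarith [bound c hc r]
  refine le_of_forall_pos_le_add fun ε hε => ?_
  nlinarith [bound_limit (ε / 2) (half_pos hε), hs.1, ht.2]

theorem maximallyIncompatible_of_isBlindTo [Countable ι] [Nonempty ι] [Nonempty Ω]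
    {B : Observable Ω H} (hA : A.HasRankOneAtoms) (hAB : A.IsBlindTo B) :
    MaximallyIncompatible A B :=
  Set.ext fun ⟨_, _⟩ =>
    ⟨fun h => ⟨h.1, h.2.1, add_le_one_of_mem_jointMeasurabilityRegion hA hAB h⟩,
      fun ⟨hs, ht, hst⟩ => mem_jointMeasurabilityRegion_of_add_le_one A B hs ht hst⟩

end Criterion

section NumberAndPhase

theorem numberObservable_singleton (n : ℕ) : numberObservable {n} =
    InnerProductSpace.rankOne ℂ (lp.single 2 n 1 : FockSpace) (lp.single 2 n 1) := by
  ext x k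
  change numberOp {n} x k = _
  by_cases hk : k = n <;> simp [numberOp_apply, hk, lp.inner_single_left]

theorem hasRankOneAtoms_numberObservable : numberObservable.HasRankOneAtoms := fun n =>
  ⟨lp.single 2 n 1, by rw [lp.norm_single two_pos, norm_one], numberObservable_singleton n⟩

theorem distribution_numberObservable_real_singleton (x : FockSpace) (n : ℕ) :
    (numberObservable.distribution x).real {n} = ‖x n‖ ^ 2 := by
  rw [Observable.distribution_real_singleton_of_rankOne (numberObservable_singleton n),
    lp.inner_single_left, RCLike.inner_apply, map_one, mul_one]

theorem distribution_phaseObservable_real (x : FockSpace) {X : Set PhaseSpace}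
    (hX : MeasurableSet X) :
    (phaseObservable.distribution x).real X = ∫ θ in X, ‖phaseIsometry x θ‖ ^ 2 ∂phaseMeasure := by
  rw [Observable.distribution_real _ _ hX]
  change (⟪x, phaseOp X x⟫_ℂ).re = _
  rw [inner_phaseOp]
  simp only [inner_self_eq_norm_sq_to_K]
  norm_cast

theorem phaseIsometry_single_ae_eq (n : ℕ) (a : ℂ) :
    phaseIsometry (lp.single 2 n a) =ᵐ[phaseMeasure] fun θ => a * phaseChar n θ := by
  rw [phaseIsometry, OrthogonalFamily.linearIsometry_apply_single,
    LinearIsometry.toSpanSingleton_apply]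
  filter_upwards [Lp.coeFn_smul a ((memLp_phaseChar n).toLp (phaseChar n)),
    (memLp_phaseChar n).coeFn_toLp] with θ hsmul hchar
  rw [hsmul, Pi.smul_apply, hchar, smul_eq_mul]

theorem phaseIsometry_sum_single_ae_eq (F : Finset ℕ) (a : ℕ → ℂ) :
    phaseIsometry (∑ n ∈ F, lp.single 2 n (a n)) =ᵐ[phaseMeasure]
      fun θ => ∑ n ∈ F, a n * phaseChar n θ := by
  induction F using Finset.induction_on with
  | empty =>
    simp only [Finset.sum_empty, map_zero]
    exact Lp.coeFn_zero _ _ _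
  | insert k F hk ih =>
    simp only [Finset.sum_insert hk, map_add]
    exact (Lp.coeFn_add _ _).trans ((phaseIsometry_single_ae_eq k (a k)).add ih)

/-- The point `e^{iθ}` of the unit circle, so that phases can be separated by open sets. -/
def phaseToCircle (θ : PhaseSpace) : Circle := Circle.exp θ

theorem continuous_phaseToCircle : Continuous phaseToCircle :=
  Circle.exp.continuous.comp continuous_subtype_val

theorem phaseChar_eq_pow (n : ℕ) (θ : PhaseSpace) :
    phaseChar n θ = ((phaseToCircle θ)⁻¹ : Circle) ^ n := by
  rw [phaseChar, phaseToCircle, ← Circle.exp_neg, Circle.coe_exp, ← Complex.exp_nat_mul]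
  congr 1
  push_cast
  ring

/-- The truncated phase state `m^{-1/2} ∑_{n < m} ζⁿ |n⟩`, whose phase is concentrated around `ζ`
for large `m`. -/
def phaseState (m : ℕ) (ζ : Circle) : FockSpace :=
  ∑ n ∈ Finset.range m, lp.single 2 n ((√m)⁻¹ * ζ ^ n : ℂ)

theorem norm_phaseState_coeff (m : ℕ) (ζ : Circle) (n : ℕ) :
    ‖((√m)⁻¹ * ζ ^ n : ℂ)‖ = (√m)⁻¹ := by
  rw [norm_mul, norm_pow, Circle.norm_coe, one_pow, mul_one, Complex.norm_of_nonneg (by positivity)]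

theorem distribution_numberObservable_phaseState (m : ℕ) (ζ ζ' : Circle) :
    numberObservable.distribution (phaseState m ζ) =
      numberObservable.distribution (phaseState m ζ') := by
  have norm_apply (ζ : Circle) (n : ℕ) :
      ‖phaseState m ζ n‖ = if n < m then (√m)⁻¹ else 0 := by
    rw [phaseState, lp.coeFn_sum, Finset.sum_apply]
    simp only [lp.single_apply, Pi.single_apply, Finset.sum_ite_eq, Finset.mem_range]
    rw [apply_ite norm, norm_phaseState_coeff, norm_zero]
  refine Measure.ext_of_singleton fun n => (measureReal_eq_measureReal_iff).1 ?_
  simp only [distribution_numberObservable_real_singleton, norm_apply]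

theorem norm_phaseState {m : ℕ} (hm : 0 < m) (ζ : Circle) : ‖phaseState m ζ‖ = 1 := by
  have norm_sq : ‖phaseState m ζ‖ ^ 2 = ∑ n ∈ Finset.range m, ‖((√m)⁻¹ * ζ ^ n : ℂ)‖ ^ 2 := by
    simpa only [ENNReal.toReal_ofNat, Real.rpow_two, phaseState] using lp.norm_sum_single (p := 2)
      (by norm_num) (fun n => ((√m)⁻¹ * ζ ^ n : ℂ)) (Finset.range m)
  simp only [norm_phaseState_coeff, inv_pow, Real.sq_sqrt m.cast_nonneg, Finset.sum_const,
    Finset.card_range, nsmul_eq_mul] at norm_sq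
  rwa [mul_inv_cancel₀ (by positivity), pow_eq_one_iff_of_nonneg (norm_nonneg _) two_ne_zero]
    at norm_sq

theorem norm_phaseState_amplitude_sq_le (m : ℕ) (ζ : Circle) {ρ : ℝ} (hρ : 0 < ρ) {θ : PhaseSpace}
    (h : ρ ≤ dist (phaseToCircle θ) ζ) :
    ‖∑ n ∈ Finset.range m, ((√m)⁻¹ * ζ ^ n : ℂ) * phaseChar n θ‖ ^ 2 ≤ (2 / ρ) ^ 2 / m := by
  set u := phaseToCircle θ
  set z : ℂ := ζ * (u⁻¹ : Circle) with hz
  have hsum : ∑ n ∈ Finset.range m, ((√m)⁻¹ * ζ ^ n : ℂ) * phaseChar n θ =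
      (√m)⁻¹ * ∑ n ∈ Finset.range m, z ^ n := by
    rw [Finset.mul_sum]
    refine Finset.sum_congr rfl fun n _ => ?_
    rw [phaseChar_eq_pow, hz, mul_pow, mul_assoc]
  have hdist : ‖z - 1‖ = dist u ζ := by
    have hu : (u : ℂ) * (u⁻¹ : Circle) = 1 := by
      rw [← Circle.coe_mul, mul_inv_cancel, Circle.coe_one]
    rw [hz, ← hu, ← sub_mul, norm_mul, Circle.norm_coe, mul_one, dist_comm]
    exact (dist_eq_norm (ζ : ℂ) u).symm
  have hz_norm : ‖z‖ = 1 := by rw [hz, norm_mul, Circle.norm_coe, Circle.norm_coe, mul_one]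
  have hgeom : ‖∑ n ∈ Finset.range m, z ^ n‖ ≤ 2 / ρ := by
    rw [le_div_iff₀ hρ]
    calc _ ≤ ‖∑ n ∈ Finset.range m, z ^ n‖ * ‖z - 1‖ := by gcongr; exact h.trans_eq hdist.symm
      _ ≤ 2 := norm_geom_sum_mul_norm_sub_one_le hz_norm.le m
  calc _ = ‖∑ n ∈ Finset.range m, z ^ n‖ ^ 2 / m := by
        rw [hsum, norm_mul, mul_pow, Complex.norm_real, norm_inv, Real.norm_eq_abs, inv_pow,
          sq_abs, Real.sq_sqrt m.cast_nonneg, inv_mul_eq_div]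
    _ ≤ _ := by gcongr

theorem one_sub_le_distribution_phaseState {m : ℕ} (hm : 0 < m) (ζ : Circle) {ρ : ℝ} (hρ : 0 < ρ)
    {X : Set PhaseSpace} (hX : MeasurableSet X) (h : phaseToCircle ⁻¹' Metric.ball ζ ρ ⊆ X) :
    1 - (2 / ρ) ^ 2 / m ≤ (phaseObservable.distribution (phaseState m ζ)).real X := by
  have total := phaseObservable.distribution_real_univ (phaseState m ζ)
  rw [norm_phaseState hm, one_pow, ← measureReal_add_measureReal_compl hX] at total
  suffices tail : (phaseObservable.distribution (phaseState m ζ)).real Xᶜ ≤ (2 / ρ) ^ 2 / m by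
    linarith
  have amplitude_le : ∀ᵐ θ ∂phaseMeasure, θ ∈ Xᶜ →
      ‖‖phaseIsometry (phaseState m ζ) θ‖ ^ 2‖ ≤ (2 / ρ) ^ 2 / m := by
    filter_upwards [phaseIsometry_sum_single_ae_eq (Finset.range m) fun n => (√m)⁻¹ * (ζ : ℂ) ^ n]
      with θ hθ hθX
    rw [norm_pow, norm_norm, phaseState, hθ]
    exact norm_phaseState_amplitude_sq_le m ζ hρ (not_lt.1 fun hlt => hθX (h hlt))
  rw [distribution_phaseObservable_real _ hX.compl]
  calc _ ≤ _ := Real.le_norm_self _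
    _ ≤ (2 / ρ) ^ 2 / m * phaseMeasure.real Xᶜ :=
      norm_setIntegral_le_of_norm_le_const_ae' (measure_lt_top _ _) amplitude_le
    _ ≤ (2 / ρ) ^ 2 / m := mul_le_of_le_one_right (by positivity) measureReal_le_one

theorem tendsto_distribution_phaseState {ζ : Circle} {U : Set Circle} (hU : IsOpen U)
    (hζ : ζ ∈ U) :
    Tendsto (fun m => (phaseObservable.distribution (phaseState m ζ)).real (phaseToCircle ⁻¹' U))
      atTop (𝓝 1) := by
  obtain ⟨ρ, hρ, hball⟩ := Metric.isOpen_iff.1 hU ζ hζ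
  have lower : Tendsto (fun m : ℕ => 1 - (2 / ρ) ^ 2 / (m : ℝ)) atTop (𝓝 1) := by
    simpa only [sub_zero] using
      (tendsto_const_div_atTop_nhds_zero_nat ((2 / ρ) ^ 2)).const_sub (1 : ℝ)
  refine tendsto_of_tendsto_of_tendsto_of_le_of_le' lower tendsto_const_nhds ?_ ?_ <;>
    filter_upwards [eventually_gt_atTop 0] with m hm
  · exact one_sub_le_distribution_phaseState hm ζ hρ
      (hU.preimage continuous_phaseToCircle).measurableSet (preimage_mono hball)
  · refine (measureReal_mono (subset_univ _)).trans_eq ?_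
    rw [Observable.distribution_real_univ, norm_phaseState hm, one_pow]

theorem isBlindTo_numberObservable_phaseObservable :
    numberObservable.IsBlindTo phaseObservable := by
  intro r ε hε
  have : Infinite Circle := Circle.argEquiv.infinite_iff.2
    (Ioc_infinite (neg_lt_self Real.pi_pos)).to_subtype
  let ζ : Fin r ↪ Circle := Fin.valEmbedding.trans (Infinite.natEmbedding Circle)
  obtain ⟨U, hU, hd⟩ := (finite_range ζ).t2_separation
  have localized : ∀ᶠ m in atTop, ∀ j, 1 - ε ≤
      (phaseObservable.distribution (phaseState m (ζ j))).real (phaseToCircle ⁻¹' U (ζ j)) :=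
    eventually_all.2 fun j =>
      (tendsto_distribution_phaseState (hU _).2 (hU _).1).eventually_const_le (sub_lt_self 1 hε)
  obtain ⟨m, hloc, hm⟩ := (localized.and (eventually_gt_atTop 0)).exists
  exact ⟨fun j => phaseState m (ζ j), fun j => phaseToCircle ⁻¹' U (ζ j),
    fun j => norm_phaseState hm _, fun _ _ => distribution_numberObservable_phaseState m _ _,
    fun j => ((hU _).2.preimage continuous_phaseToCircle).measurableSet,
    fun i j hij => (hd (mem_range_self i) (mem_range_self j) (ζ.injective.ne hij)).preimage _,
    hloc⟩

instance : Nonempty PhaseSpace := ⟨⟨0, le_rfl, Real.two_pi_pos⟩⟩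

theorem maximallyIncompatible_numberObservable_phaseObservable :
    MaximallyIncompatible numberObservable phaseObservable :=
  maximallyIncompatible_of_isBlindTo hasRankOneAtoms_numberObservable
    isBlindTo_numberObservable_phaseObservable

end NumberAndPhase

end QuantumObservables

end

theorem theorem3 :
    QuantumObservables.MaximallyIncompatible
        QuantumObservables.numberObservable QuantumObservables.phaseObservable ∧
      QuantumObservables.IsJointMeasurabilityDegree
        QuantumObservables.numberObservable QuantumObservables.phaseObservable (1 / 2) := by
  have maximal := QuantumObservables.maximallyIncompatible_numberObservable_phaseObservable
  exact ⟨maximal, maximal.isJointMeasurabilityDegree⟩
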